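/- A \emph{round-based register protocol} is a tuple $\mathcal P=\langle Q,q_0,\mathsf d,\mathsf D,\mathsf v,\Delta\rangle$, where $Q$ is a finite set of states with initial state $q_0$; $\mathsf d\in\mathbb N$ is the number of shared registers per round; $\mathsf D$ is a finite data alphabet containing the initial value $d_0$; $\mathsf v\in\mathbb N$ is the visibility range; and $\Delta\subseteq Q\times A\times Q$ is the set of transitions. The set $A$ of actions consists of $\mathsf{Inc}$, of $\mathsf{read}^{-i}_\alpha(x)$ for $0\le i\le\mathsf v$, $1\le\alpha\le\mathsf d$, $x\in\mathsf D$, and of $\mathsf{write}_\alpha(x)$ for $1\le\alpha\le\mathsf d$, $x\in\mathsf D\setminus\{d_0\}$. Its size is $|\mathcal P|=|Q|+|\mathsf D|+|\Delta|+\mathsf v+\mathsf d$. A \emph{concrete configuration} $\gamma$ consists of a finite multiset over $Q\times\mathbb N$ (the number of processes in each state at each round) and a value in $\mathsf D$ for each register $(k,\alpha)$, $k\in\mathbb N$, $1\le\alpha\le\mathsf d$. We write $(q,k)\in\gamma$ if at least one process of $\gamma$ is in state $q$ at round $k$. The initial configuration $\mathrm{init}_n$ has $n$ processes, all in $q_0$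 at round $0$, and all registers equal to $d_0$. In one step, one process, in some state $q$ at some round $k$, takes a transition $(q,a,q')\in\Delta$ and moves to state $q'$: if $a=\mathsf{Inc}$, it moves to round $k+1$; if $a=\mathsf{read}^{-i}_\alpha(x)$, it stays at round $k$, and the step requires that register $(k-i,\alpha)$ holds $x$ (registers of negative rounds hold $d_0$); if $a=\mathsf{write}_\alpha(x)$, it stays at round $k$, and register $(k,\alpha)$ is set to $x$. Everything else is unchanged. A \emph{concrete execution} $\gamma\to^*\gamma'$ is a finite sequence of steps. The pair $(\mathcal P,q_{\mathrm{err}})$ with $q_{\mathrm{err}}\in Q$ is a \emph{negative instance of the safety problem} if there are $n,k\in\mathbb N$ and an execution $\mathrm{init}_n\to^*\gamma$ with $(q_{\mathrm{err}},k)\in\gamma$. \textbf{Corollary.} There are polynomials $p,r$ with coefficients in $\mathbb N$ such that for every round-based register protocol $\mathcal P$ and every state $q_{\mathrm{err}}$: if $(\mathcal P,q_{\mathrm{err}})$ is a negative instance of the safety problem, then, with $K=2^{p(|\mathcal P|)}$ and $N=2^{r(|\mathcal P|)}$, there exist $k\le K$ and a concrete execution $\mathrm{init}_N\to^*\gamma$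 such that $(q_{\mathrm{err}},k)\in\gamma$. -/

import Mathlib

/-- Actions with data alphabet `D`, initial (non-writable) value `d₀`, `d` registers per round
and visibility range `v`: increment the round, read the value `x` from register `α` of the round
lying `i ≤ v` rounds before the current one, or write a value `x ≠ d₀` to register `α` of the
current round. -/
inductive RoundAction (D : Type*) (d₀ : D) (d v : ℕ)
  | incr : RoundAction D d₀ d v
  | read (i : Fin (v + 1)) (α : Fin d) (x : D) : RoundAction D d₀ d v
  | write (α : Fin d) (x : {x : D // x ≠ d₀}) : RoundAction D d₀ d v

/-- A round-based register protocol with set of states `Q` and data alphabet `D`. -/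
structure RoundProtocol (Q D : Type*) where
  /-- the initial state -/
  init : Q
  /-- the number of shared registers per round -/
  rdim : ℕ
  /-- the initial value of the registers -/
  blank : D
  /-- the visibility range -/
  vis : ℕ
  /-- the set of transitions -/
  transitions : Finset (Q × RoundAction D blank rdim vis × Q)

namespace RoundProtocol

variable {Q D : Type*}

/-- The size of a protocol (the visibility range is counted in unary). -/
def size [Fintype Q] [Fintype D] (P : RoundProtocol Q D) : ℕ :=
  Fintype.card Q + Fintype.card D + P.transitions.card + P.vis + P.rdim

/-- A concrete configuration: a finite multiset of locations (state, round), giving the number of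
processes at each location, and a value for each register (round, identifier). -/
structure Config (P : RoundProtocol Q D) where
  /-- the number of processes at each location -/
  locs : (Q × ℕ) →₀ ℕ
  /-- the content of each register -/
  data : ℕ × Fin P.rdim → D

/-- The initial configuration with `n` processes. -/
noncomputable def initConfig (P : RoundProtocol Q D) (n : ℕ) : P.Config where
  locs := Finsupp.single (P.init, 0) n
  data := fun _ => P.blank

/-- The value of register `α` of round `k - i`; registers of negative rounds always hold the
initial value. -/
def Config.lookback {P : RoundProtocol Q D} (c : P.Config) (k i : ℕ) (α : Fin P.rdim) : D :=
  if i ≤ k then c.data (k - i, α) else P.blank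

/-- One process leaves location `l` for location `l'`. -/
noncomputable def moveOne (m : (Q × ℕ) →₀ ℕ) (l l' : Q × ℕ) : (Q × ℕ) →₀ ℕ :=
  m - Finsupp.single l 1 + Finsupp.single l' 1

/-- `P.Step c c'`: the concrete configuration `c'` is a successor of `c`, by a move of a process
in some state `q` at some round `k`. -/
inductive Step (P : RoundProtocol Q D) : P.Config → P.Config → Prop
  | incr (c : P.Config) (q q' : Q) (k : ℕ)
      (htr : (q, RoundAction.incr, q') ∈ P.transitions)
      (hpos : 0 < c.locs (q, k)) :
      Step P c ⟨moveOne c.locs (q, k) (q', k + 1), c.data⟩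
  | read (c : P.Config) (q q' : Q) (k : ℕ) (i : Fin (P.vis + 1)) (α : Fin P.rdim) (x : D)
      (htr : (q, RoundAction.read i α x, q') ∈ P.transitions)
      (hval : c.lookback k i α = x)
      (hpos : 0 < c.locs (q, k)) :
      Step P c ⟨moveOne c.locs (q, k) (q', k), c.data⟩
  | write (c : P.Config) (q q' : Q) (k : ℕ) (α : Fin P.rdim) (x : {x : D // x ≠ P.blank})
      (htr : (q, RoundAction.write α x, q') ∈ P.transitions)
      (hpos : 0 < c.locs (q, k)) :
      Step P c ⟨moveOne c.locs (q, k) (q', k), Function.update c.data (k, α) x⟩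

/-- `P.Reach c c'`: there is a concrete execution from `c` to `c'`. -/
def Reach (P : RoundProtocol Q D) : P.Config → P.Config → Prop :=
  Relation.ReflTransGen P.Step

/-- `(P, qerr)` is a positive instance of the safety problem: whatever the number of processes, no
reachable configuration has a process in state `qerr`, at any round. -/
def IsSafe (P : RoundProtocol Q D) (qerr : Q) : Prop :=
  ∀ (n : ℕ) (c : P.Config), P.Reach (P.initConfig n) c → ∀ k : ℕ, c.locs (qerr, k) = 0

end RoundProtocol

/-! Since the number of processes is unbounded, an occupied location can be filled with as many
processes as needed, and a value once writable can be rewritten whenever somebody wants to read it.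
The blank value cannot be restored, so blank reads must precede the first write. Hence only the
order of the first occupations and first writes matters, and this is what a `Timing` records.

Concrete executions yield valid timings (`exists_accounts_of_reach`). A justification looks back
boundedly many rounds and uses only the order of times. If two windows of `vis + 1` rounds are
ordered alike, the rounds between them can therefore be cut out, the later part being re-timed by a
strictly monotone map; such a map exists by density of `ℚ`. There are exponentially many window
orders, so pigeonhole bounds the round (`IsValid.exists_le`). Conversely, `IsValid.realisable`
executes a valid timing event by event, at the cost of at most one extra process per event, which
bounds the number of processes (`IsValid.exists_reach`). -/

/-! ### Extending finite order correspondences. -/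

/-- A strictly order-preserving correspondence between two finite families of elements of
`WithTop ℚ` that matches `⊤` with `⊤` extends to a strictly monotone map. -/
theorem exists_strictMono_extension {ι : Type*} [Finite ι] (f g : ι → WithTop ℚ)
    (hlt : ∀ a b, f a < f b ↔ g a < g b) (htop : ∃ a, f a = ⊤ ∧ g a = ⊤) :
    ∃ φ : WithTop ℚ → WithTop ℚ, StrictMono φ ∧ φ ⊤ = ⊤ ∧ ∀ a, φ (f a) = g a := by
  classical
  obtain ⟨o, hfo, hgo⟩ := htop
  have hfin : ∀ a, f a < ⊤ ↔ g a < ⊤ := fun a => by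
    have := hlt a o
    rwa [hfo, hgo] at this
  have hcmp : ∀ a b, f a < ⊤ → f b < ⊤ →
      cmp ((f a).untopD 0) ((f b).untopD 0) = cmp ((g a).untopD 0) ((g b).untopD 0) := by
    intro a b ha hb
    have ha' := (hfin a).1 ha
    have hb' := (hfin b).1 hb
    have h1 := hlt a b
    have h2 := hlt b a
    obtain ⟨x, hx⟩ := WithTop.ne_top_iff_exists.1 ha.ne
    obtain ⟨y, hy⟩ := WithTop.ne_top_iff_exists.1 hb.ne
    obtain ⟨x', hx'⟩ := WithTop.ne_top_iff_exists.1 ha'.ne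
    obtain ⟨y', hy'⟩ := WithTop.ne_top_iff_exists.1 hb'.ne
    rw [← hx, ← hy, ← hx', ← hy'] at h1 h2 ⊢
    simp only [WithTop.coe_lt_coe] at h1 h2
    simp only [WithTop.untopD_coe]
    rcases lt_trichotomy x y with h | h | h
    · rw [(cmp_eq_lt_iff _ _).2 h, (cmp_eq_lt_iff _ _).2 (h1.1 h)]
    · have : x' = y' := le_antisymm (not_lt.1 fun h' => (h2.2 h').ne h.symm)
        (not_lt.1 fun h' => (h1.2 h').ne h)
      rw [(cmp_eq_eq_iff _ _).2 h, (cmp_eq_eq_iff _ _).2 this]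
    · rw [(cmp_eq_gt_iff _ _).2 h, (cmp_eq_gt_iff _ _).2 (h2.1 h)]
  let S : Set (ℚ × ℚ) := (fun a => ((f a).untopD 0, (g a).untopD 0)) '' {a | f a < ⊤}
  have hS : S.Finite := (Set.toFinite _).image _
  let p : Order.PartialIso ℚ ℚ := ⟨hS.toFinset, by
    intro x hx y hy
    rw [Set.Finite.mem_toFinset] at hx hy
    obtain ⟨a, ha, rfl⟩ := hx
    obtain ⟨b, hb, rfl⟩ := hy
    exact hcmp a b ha hb⟩
  -- The "forth" half of Cantor's back-and-forth: `p` grows to a map defined on all of `ℚ`;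
  -- surjectivity is not needed.
  let I : Order.Ideal (Order.PartialIso ℚ ℚ) :=
    Order.idealOfCofinals p (Order.PartialIso.definedAtLeft ℚ)
  let F : ∀ x : ℚ, { b : ℚ // ∃ f ∈ I, (x, b) ∈ Subtype.val f } := fun x =>
    Order.PartialIso.funOfIdeal x I (Order.cofinal_meets_idealOfCofinals _ _ x)
  have hF : ∀ m ∈ I, ∀ m' ∈ I, ∀ x y x' y' : ℚ, (x, x') ∈ m.val → (y, y') ∈ m'.val →
      cmp x y = cmp x' y' := by
    intro m hm m' hm' x y x' y' hx hy
    obtain ⟨n, -, hn, hn'⟩ := I.directed _ hm _ hm'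
    exact n.prop (x, x') (hn hx) (y, y') (hn' hy)
  refine ⟨WithTop.map fun x => (F x).1, ?_, rfl, ?_⟩
  · refine WithTop.strictMono_map_iff.2 fun x y hxy => ?_
    obtain ⟨m, hm, hx⟩ := (F x).2
    obtain ⟨m', hm', hy⟩ := (F y).2
    exact (lt_iff_lt_of_cmp_eq_cmp (hF m hm m' hm' _ _ _ _ hx hy)).1 hxy
  · intro a
    by_cases ha : f a < ⊤
    · have ha' := (hfin a).1 ha
      have hmem : ((f a).untopD 0, (g a).untopD 0) ∈ p.val := by
        change _ ∈ hS.toFinset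
        rw [Set.Finite.mem_toFinset]
        exact ⟨a, ha, rfl⟩
      obtain ⟨x, hx⟩ := WithTop.ne_top_iff_exists.1 ha.ne
      obtain ⟨x', hx'⟩ := WithTop.ne_top_iff_exists.1 ha'.ne
      rw [← hx, ← hx'] at hmem ⊢
      simp only [WithTop.untopD_coe] at hmem
      obtain ⟨m, hm, hm'⟩ := (F x).2
      have := hF m hm p (Order.mem_idealOfCofinals _ _) _ _ _ _ hm' hmem
      rw [cmp_self_eq_eq] at this
      rw [WithTop.map_coe, (cmp_eq_eq_iff _ _).1 this.symm]
    · have ha' := mt (hfin a).2 ha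
      rw [not_lt_top_iff] at ha ha'
      rw [ha, ha']
      rfl

namespace RoundProtocol

variable {Q D : Type*}

/-! ### Timings as abstract executions. -/

/-- Time stamps for the events of an abstract execution: `t (Sum.inl q) k` is the time at which
the location `(q, k)` is first occupied and `t (Sum.inr α) k` the time of the first write to
register `α` of round `k`; events that never happen have time `⊤`. -/
abbrev Timing (P : RoundProtocol Q D) := Q ⊕ Fin P.rdim → ℕ → WithTop ℚ

/-- The event `(a, k)` may happen at time `s`, given the times of the other events. -/
inductive Justified (P : RoundProtocol Q D) (t : P.Timing) (s : WithTop ℚ) :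
    Q ⊕ Fin P.rdim → ℕ → Prop
  | init : Justified P t s (Sum.inl P.init) 0
  | incr (q q' : Q) (j k : ℕ) (hk : k = j + 1)
      (htr : (q, RoundAction.incr, q') ∈ P.transitions)
      (hq : t (Sum.inl q) j < s) : Justified P t s (Sum.inl q') k
  | readBlank (q q' : Q) (k : ℕ) (i : Fin (P.vis + 1)) (α : Fin P.rdim)
      (htr : (q, RoundAction.read i α P.blank, q') ∈ P.transitions)
      (hq : t (Sum.inl q) k < s)
      (hα : ∀ j, j + i = k → s < t (Sum.inr α) j) : Justified P t s (Sum.inl q') k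
  | readWritten (q q' : Q) (j k : ℕ) (i : Fin (P.vis + 1)) (α : Fin P.rdim)
      (x : {x : D // x ≠ P.blank}) (w w' : Q) (hk : j + i = k)
      (htr : (q, RoundAction.read i α x.1, q') ∈ P.transitions)
      (hq : t (Sum.inl q) k < s) (hα : t (Sum.inr α) j < s)
      (hwtr : (w, RoundAction.write α x, w') ∈ P.transitions)
      (hw : t (Sum.inl w) j < s) : Justified P t s (Sum.inl q') k
  | write (q q' : Q) (k : ℕ) (α : Fin P.rdim) (x : {x : D // x ≠ P.blank})
      (htr : (q, RoundAction.write α x, q') ∈ P.transitions)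
      (hq : t (Sum.inl q) k < s) (hα : t (Sum.inr α) k < s) : Justified P t s (Sum.inl q') k
  | firstWrite (q q' : Q) (k : ℕ) (α : Fin P.rdim) (x : {x : D // x ≠ P.blank})
      (htr : (q, RoundAction.write α x, q') ∈ P.transitions)
      (hq : t (Sum.inl q) k < s) : Justified P t s (Sum.inr α) k

/-- Every event that happens is justified by earlier events. -/
def IsValid (P : RoundProtocol Q D) (t : P.Timing) : Prop :=
  ∀ a k, t a k < ⊤ → P.Justified t (t a k) a k

/-- Justifications are local and may be shifted by `δ` rounds. -/
theorem Justified.transport {P : RoundProtocol Q D} {t t' : P.Timing} {s s' : WithTop ℚ}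
    {a : Q ⊕ Fin P.rdim} {k δ : ℕ} (hδ : δ = 0 ∨ (P.vis ≤ k ∧ 1 ≤ k))
    (hlt : ∀ b j, j ≤ k → k ≤ j + max P.vis 1 → t b (j + δ) < s → t' b j < s')
    (hgt : ∀ α j, a ≠ Sum.inr α → j ≤ k → k ≤ j + P.vis → s < t (Sum.inr α) (j + δ) →
      s' < t' (Sum.inr α) j)
    (h : P.Justified t s a (k + δ)) : P.Justified t' s' a k := by
  generalize hK : k + δ = K at h
  cases h with
  | init =>
    obtain rfl : k = 0 := by omega
    exact .init
  | incr q q' j _ hk htr hq =>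
    -- An increment looks back one round even when `P.vis = 0`: hence `max P.vis 1` and `1 ≤ k` in
    -- the hypotheses.
    obtain ⟨l, rfl⟩ : ∃ l, k = l + 1 := ⟨k - 1, by omega⟩
    obtain rfl : j = l + δ := by omega
    exact .incr q q' l _ rfl htr (hlt _ _ (by omega) (by omega) hq)
  | readBlank q q' _ i α htr hq hα =>
    subst hK
    refine .readBlank q q' k i α htr (hlt _ _ le_rfl (by omega) hq) fun j hj => ?_
    exact hgt _ _ (by simp) (by omega) (by omega) (hα _ (by omega))
  | readWritten q q' j _ i α x w w' hk htr hq hα hwtr hw =>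
    subst hK
    have := i.2
    obtain ⟨l, rfl⟩ : ∃ l, j = l + δ := ⟨j - δ, by omega⟩
    exact .readWritten q q' l k i α x w w' (by omega) htr (hlt _ _ le_rfl (by omega) hq)
      (hlt _ _ (by omega) (by omega) hα) hwtr (hlt _ _ (by omega) (by omega) hw)
  | write q q' _ α x htr hq hα =>
    subst hK
    exact .write q q' k α x htr (hlt _ _ le_rfl (by omega) hq) (hlt _ _ le_rfl (by omega) hα)
  | firstWrite q q' _ α x htr hq =>
    subst hK
    exact .firstWrite q q' k α x htr (hlt _ _ le_rfl (by omega) hq)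

/-- A justified event can be added to a valid timing at a time later than all others. -/
theorem IsValid.exists_extend {P : RoundProtocol Q D} {t : P.Timing} (ht : P.IsValid t) {m : ℚ}
    (hm : ∀ b j, t b j < ⊤ → t b j < m) {a : Q ⊕ Fin P.rdim} {k : ℕ}
    (ha : P.Justified t m a k) :
    ∃ t' : P.Timing, P.IsValid t' ∧ (∃ m' : ℚ, ∀ b j, t' b j < ⊤ → t' b j < m') ∧ t' a k < ⊤ ∧
      (∀ b j, t b j < ⊤ → t' b j < ⊤) ∧ ∀ b j, (b, j) ≠ (a, k) → t' b j = t b j := by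
  classical
  by_cases hak : t a k < ⊤
  · exact ⟨t, ht, ⟨m, hm⟩, hak, fun _ _ h => h, fun _ _ _ => rfl⟩
  let t' : P.Timing := fun b j => if (b, j) = (a, k) then (m : WithTop ℚ) else t b j
  have hself : t' a k = m := if_pos rfl
  have hne : ∀ b j, (b, j) ≠ (a, k) → t' b j = t b j := fun b j h => if_neg h
  have hlt : ∀ (s : WithTop ℚ) b j, t b j < s → t' b j < s := by
    intro s b j h
    rw [hne _ _ ?_]
    · exact h
    · rintro ⟨⟩
      exact hak (h.trans_le le_top)
  refine ⟨t', ?_, ⟨m + 1, ?_⟩, ?_, fun b j => hlt ⊤ b j, hne⟩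
  · intro b j hb
    by_cases hbj : (b, j) = (a, k)
    · cases hbj
      rw [hself]
      refine Justified.transport (δ := 0) (Or.inl rfl) (fun _ _ _ _ => hlt _ _ _) ?_ ha
      intro α j hα _ _ h
      rwa [hne _ _ fun h' => hα (Prod.ext_iff.1 h').1.symm]
    · rw [hne _ _ hbj] at hb ⊢
      refine Justified.transport (δ := 0) (Or.inl rfl) (fun _ _ _ _ => hlt _ _ _) ?_ (ht b j hb)
      intro α l _ _ _ h
      -- Earlier blank reads stay justified, because a new first write is later than every event
      -- that happens.
      by_cases hα : (Sum.inr α, l) = (a, k)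
      · cases hα
        rw [hself]
        exact hm _ _ hb
      · rwa [hne _ _ hα]
  · have hmm : (m : WithTop ℚ) < ((m + 1 : ℚ) : WithTop ℚ) := by
      rw [WithTop.coe_lt_coe]; linarith
    intro b j hb
    by_cases hbj : (b, j) = (a, k)
    · cases hbj
      rwa [hself]
    · rw [hne _ _ hbj] at hb ⊢
      exact (hm b j hb).trans hmm
  · rw [hself]
    exact WithTop.coe_lt_top m

/-! ### From concrete executions to timings. -/

/-- The timing `t` accounts for everything present in the configuration `c`. -/
structure Accounts (P : RoundProtocol Q D) (t : P.Timing) (c : P.Config) : Prop where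
  valid : P.IsValid t
  bounded : ∃ m : ℚ, ∀ b j, t b j < ⊤ → t b j < m
  loc : ∀ q k, 0 < c.locs (q, k) → t (Sum.inl q) k < ⊤
  blank : ∀ k α, c.data (k, α) = P.blank → t (Sum.inr α) k = ⊤
  written : ∀ k α, c.data (k, α) ≠ P.blank → t (Sum.inr α) k < ⊤ ∧
    ∃ (x : {x : D // x ≠ P.blank}) (w w' : Q), x.1 = c.data (k, α) ∧
      (w, RoundAction.write α x, w') ∈ P.transitions ∧ t (Sum.inl w) k < ⊤

theorem pos_of_moveOne_pos {m : (Q × ℕ) →₀ ℕ} {l l' l'' : Q × ℕ}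
    (h : 0 < moveOne m l l' l'') : l'' = l' ∨ 0 < m l'' := by
  classical
  by_contra! hcon
  have : l' ≠ l'' := fun h => hcon.1 h.symm
  simp [moveOne, Finsupp.single_apply, this] at h
  omega

/-- Occupying one more justified location. -/
theorem Accounts.move {P : RoundProtocol Q D} {t : P.Timing} {c : P.Config}
    (h : P.Accounts t c) {m : ℚ} (hm : ∀ b j, t b j < ⊤ → t b j < m) {q' : Q} {k' : ℕ}
    {l : Q × ℕ} (hj : P.Justified t m (Sum.inl q') k') :
    ∃ t' : P.Timing, P.Accounts t' ⟨moveOne c.locs l (q', k'), c.data⟩ := by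
  obtain ⟨t', hv, hb, hlt, hmono, hne⟩ := h.valid.exists_extend hm hj
  refine ⟨t', hv, hb, ?_, ?_, ?_⟩
  · intro q k hpos
    rcases pos_of_moveOne_pos hpos with h' | h'
    · cases h'
      exact hlt
    · exact hmono _ _ (h.loc _ _ h')
  · intro k α hα
    rw [hne _ _ (by simp)]
    exact h.blank k α hα
  · intro k α hα
    obtain ⟨h1, x, w, w', hx, hw, hw'⟩ := h.written k α hα
    exact ⟨hmono _ _ h1, x, w, w', hx, hw, hmono _ _ hw'⟩

/-- A step adds at most one new event, except a write, which may add two: the first write is timed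
before the occupation of the target, so that it can justify the latter. Events that have already
happened keep their time. -/
theorem Accounts.exists_step {P : RoundProtocol Q D} {t : P.Timing} {c c' : P.Config}
    (h : P.Accounts t c) (hs : P.Step c c') : ∃ t' : P.Timing, P.Accounts t' c' := by
  classical
  obtain ⟨m, hm⟩ := h.bounded
  cases hs with
  | incr q q' k htr hpos =>
    exact h.move hm (.incr q q' k _ rfl htr (hm _ _ (h.loc _ _ hpos)))
  | read q q' k i α x htr hval hpos =>
    have hq := hm _ _ (h.loc _ _ hpos)
    by_cases hx : x = P.blank
    · subst hx
      -- For a register of a negative round no such `j` exists and the condition is vacuous.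
      refine h.move hm (.readBlank q q' k i α htr hq fun j hj => ?_)
      rw [Config.lookback, if_pos (by omega)] at hval
      rw [show j = k - i by omega, h.blank _ _ hval]
      exact WithTop.coe_lt_top m
    · rw [Config.lookback] at hval
      split_ifs at hval with hi
      · rw [← hval] at hx
        obtain ⟨h1, y, w, w', hy, hw, hw'⟩ := h.written _ _ hx
        rw [hval] at hy
        subst hy
        exact h.move hm (.readWritten q q' (k - i) k i α y w w' (by omega) htr hq
          (hm _ _ h1) hw (hm _ _ hw'))
      · exact absurd hval.symm hx
  | write q q' k α x htr hpos =>
    have hq := h.loc _ _ hpos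
    obtain ⟨t₁, hv, ⟨m₁, hm₁⟩, hlt, hmono, hne⟩ :=
      h.valid.exists_extend hm (.firstWrite q q' k α x htr (hm _ _ hq))
    have h₁ : P.Accounts t₁ ⟨c.locs, Function.update c.data (k, α) x.1⟩ := by
      refine ⟨hv, ⟨m₁, hm₁⟩, fun q k hpos => hmono _ _ (h.loc q k hpos), ?_, ?_⟩
      · intro j β hβ
        by_cases hj : (j, β) = (k, α)
        · rw [hj] at hβ
          simp only [Function.update_self] at hβ
          exact absurd hβ x.2
        · simp only [Function.update_of_ne hj] at hβ
          rw [hne _ _ fun h' => hj (by cases h'; rfl)]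
          exact h.blank _ _ hβ
      · intro j β hβ
        by_cases hj : (j, β) = (k, α)
        · cases hj
          refine ⟨hlt, x, q, q', ?_, htr, hmono _ _ hq⟩
          simp only [Function.update_self]
        · simp only [Function.update_of_ne hj] at hβ ⊢
          obtain ⟨h1, y, w, w', hy, hw, hw'⟩ := h.written _ _ hβ
          exact ⟨hmono _ _ h1, y, w, w', hy, hw, hmono _ _ hw'⟩
    exact h₁.move hm₁ (.write q q' k α x htr (hm₁ _ _ (hmono _ _ hq)) (hm₁ _ _ hlt))

/-- Every reachable configuration is accounted for by a valid timing. -/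
theorem exists_accounts_of_reach {P : RoundProtocol Q D} {n : ℕ} {c : P.Config}
    (h : P.Reach (P.initConfig n) c) : ∃ t : P.Timing, P.Accounts t c := by
  classical
  induction h with
  | refl =>
    have hm : ∀ (b : Q ⊕ Fin P.rdim) (j : ℕ), (⊤ : WithTop ℚ) < ⊤ → (⊤ : WithTop ℚ) < (0 : ℚ) :=
      fun _ _ h => absurd h (lt_irrefl _)
    obtain ⟨t, hv, hb, hlt, -, hne⟩ := IsValid.exists_extend (P := P) (t := fun _ _ => ⊤)
      (fun _ _ h => absurd h (lt_irrefl _)) hm (.init)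
    refine ⟨t, hv, hb, ?_, fun k α _ => hne _ _ (by simp), fun k α h => absurd rfl h⟩
    intro q k hpos
    simp only [initConfig, Finsupp.single_apply] at hpos
    split_ifs at hpos with h
    · cases h
      exact hlt
    · exact absurd hpos (lt_irrefl _)
  | tail _ hs ih =>
    obtain ⟨t, ht⟩ := ih
    exact ht.exists_step hs

/-! ### Cutting out rounds and bounding the round. -/

/-- Removing the `δ` rounds that follow round `κ`, when the last rounds up to `κ` and up to `κ + δ`
are order-equivalent. -/
theorem IsValid.cut {P : RoundProtocol Q D} {t : P.Timing} (ht : P.IsValid t) {κ δ : ℕ}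
    (hκ : P.vis ≤ κ) {φ : WithTop ℚ → WithTop ℚ} (hφ : StrictMono φ) (htop : φ ⊤ = ⊤)
    (heq : ∀ a j, κ ≤ j + P.vis → j ≤ κ → φ (t a (j + δ)) = t a j) :
    P.IsValid fun a j => if j ≤ κ then t a j else φ (t a (j + δ)) := by
  intro a k hak
  dsimp only at hak ⊢
  by_cases hk : k ≤ κ
  · rw [if_pos hk] at hak ⊢
    refine Justified.transport (δ := 0) (Or.inl rfl) ?_ ?_ (ht a k hak)
    · intro b j hj _ h
      rwa [if_pos (hj.trans hk)]
    · intro α j _ hj _ h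
      rwa [if_pos (hj.trans hk)]
  · rw [if_neg hk] at hak ⊢
    -- On the overlap both branches agree, so a round after `κ` sees only the shifted timing `φ (t b
    -- (j + δ))`.
    have hval : ∀ b j, κ ≤ j + P.vis →
        (if j ≤ κ then t b j else φ (t b (j + δ))) = φ (t b (j + δ)) := by
      intro b j hj
      split_ifs with h
      · exact (heq b j hj h).symm
      · rfl
    have hfin : t a (k + δ) < ⊤ := by
      rw [← htop] at hak
      exact hφ.lt_iff_lt.1 hak
    refine Justified.transport (Or.inr ⟨by omega, by omega⟩) ?_ ?_ (ht a (k + δ) hfin)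
    · intro b j _ hj h
      rw [hval _ _ (by omega)]
      exact hφ h
    · intro α j _ _ hj h
      rw [hval _ _ (by omega)]
      exact hφ h

/-- The times of the events of the rounds `n, …, n + v`, together with `⊤`. -/
def windowTime (P : RoundProtocol Q D) (t : P.Timing) (n : ℕ) :
    Option ((Q ⊕ Fin P.rdim) × Fin (P.vis + 1)) → WithTop ℚ
  | none => ⊤
  | some (a, i) => t a (n + i)

/-- The relative order of the events of the rounds `n, …, n + v`. -/
def footprint (P : RoundProtocol Q D) (t : P.Timing) (n : ℕ) :
    Set (Option ((Q ⊕ Fin P.rdim) × Fin (P.vis + 1)) ×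
      Option ((Q ⊕ Fin P.rdim) × Fin (P.vis + 1))) :=
  {x | P.windowTime t n x.1 < P.windowTime t n x.2}

/-- Equal footprints make the two windows order-isomorphic; the index `none` forces events that
never happen to correspond. Cutting after the first window brings round `k + δ` down to `k`. -/
theorem IsValid.exists_of_footprint_eq [Finite Q] {P : RoundProtocol Q D} {t : P.Timing}
    (ht : P.IsValid t) {n δ k : ℕ} (hk : n + P.vis < k)
    (hf : P.footprint t n = P.footprint t (n + δ)) {a : Q ⊕ Fin P.rdim} (ha : t a (k + δ) < ⊤) :
    ∃ t' : P.Timing, P.IsValid t' ∧ t' a k < ⊤ := by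
  obtain ⟨φ, hφ, htop, heq⟩ := exists_strictMono_extension (P.windowTime t (n + δ))
    (P.windowTime t n) (fun x y => (Set.ext_iff.1 hf (x, y)).symm) ⟨none, rfl, rfl⟩
  refine ⟨_, ht.cut (κ := n + P.vis) (δ := δ) (by omega) hφ htop ?_, ?_⟩
  · intro b j hj hj'
    have := heq (some (b, ⟨j - n, by omega⟩))
    simp only [windowTime] at this
    rwa [show n + δ + (j - n) = j + δ by omega, show n + (j - n) = j by omega] at this
  · rw [if_neg (by omega), ← htop]
    exact hφ ha

/-- An event possible at some round is possible at an exponentially bounded round. -/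
theorem IsValid.exists_le [Fintype Q] {P : RoundProtocol Q D} {t : P.Timing} (ht : P.IsValid t)
    {a : Q ⊕ Fin P.rdim} {k : ℕ} (ha : t a k < ⊤) :
    ∃ k' ≤ P.vis + 2 ^ ((Fintype.card Q + P.rdim) * (P.vis + 1) + 1) ^ 2,
      ∃ t' : P.Timing, P.IsValid t' ∧ t' a k' < ⊤ := by
  classical
  -- The round is minimised over all valid timings, since cutting changes the timing.
  have hex : ∃ k, ∃ t : P.Timing, P.IsValid t ∧ t a k < ⊤ := ⟨k, t, ht, ha⟩
  refine ⟨Nat.find hex, ?_, Nat.find_spec hex⟩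
  by_contra! hgt
  obtain ⟨t', ht', ha'⟩ := Nat.find_spec hex
  set B := 2 ^ ((Fintype.card Q + P.rdim) * (P.vis + 1) + 1) ^ 2 with hB
  -- The `B + 1` windows starting at rounds `0, …, B` all end before the minimal round, and there
  -- are only `B` sets of pairs of window indices; a repetition allows a cut.
  obtain ⟨x, y, hxy, hf⟩ := Fintype.exists_ne_map_eq_of_card_lt
    (fun n : Fin (B + 1) => P.footprint t' n) (by
      simp only [Fintype.card_set, Fintype.card_prod, Fintype.card_option, Fintype.card_sum,
        Fintype.card_fin, ← sq]
      omega)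
  wlog hlt : x < y generalizing x y
  · exact this y x hxy.symm hf.symm (lt_of_le_of_ne (not_lt.1 hlt) hxy.symm)
  have hlt' : (x : ℕ) < y := hlt
  have hy := y.2
  obtain ⟨δ, hδ⟩ := Nat.exists_eq_add_of_lt hlt'
  rw [add_assoc] at hδ
  rw [hδ] at hf
  refine Nat.find_min hex (m := Nat.find hex - (δ + 1)) (by omega)
    (ht'.exists_of_footprint_eq (n := x) (δ := δ + 1) (by omega) hf ?_)
  rwa [Nat.sub_add_cancel (by omega)]

/-! ### From timings to concrete executions. -/

theorem le_moveOne {m E : (Q × ℕ) →₀ ℕ} {l l' : Q × ℕ} {n : ℕ}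
    (h : E + Finsupp.single l (n + 1) ≤ m) :
    E + Finsupp.single l' 1 + Finsupp.single l n ≤ moveOne m l l' := by
  classical
  intro x
  have := h x
  simp only [moveOne, Finsupp.add_apply, Finsupp.tsub_apply, Finsupp.single_apply] at this ⊢
  split_ifs at this ⊢ <;> omega

/-- Moving several processes from one location to another by the same transition. -/
theorem exists_reach_moveMany {P : RoundProtocol Q D} {l l' : Q × ℕ}
    (G : (ℕ × Fin P.rdim → D) → Prop)
    (hstep : ∀ c : P.Config, G c.data → 0 < c.locs l →
      ∃ d, G d ∧ P.Step c ⟨moveOne c.locs l l', d⟩)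
    (n : ℕ) (E : (Q × ℕ) →₀ ℕ) (c : P.Config) (hc : G c.data)
    (hE : E + Finsupp.single l n ≤ c.locs) :
    ∃ c', P.Reach c c' ∧ G c'.data ∧ E + Finsupp.single l' n ≤ c'.locs := by
  classical
  induction n generalizing E c with
  | zero => exact ⟨c, .refl, hc, by simpa using hE⟩
  | succ n ih =>
    have hpos : 0 < c.locs l := by
      have := hE l
      simp only [Finsupp.add_apply, Finsupp.single_eq_same] at this
      omega
    obtain ⟨d, hd, hs⟩ := hstep c hc hpos
    obtain ⟨c', hr, hc', hE'⟩ := ih (E + Finsupp.single l' 1) ⟨moveOne c.locs l l', d⟩ hd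
      (le_moveOne hE)
    refine ⟨c', .head hs hr, hc', ?_⟩
    rwa [add_assoc, ← Finsupp.single_add, add_comm 1 n] at hE'

/-- The written registers are exactly those whose first write belongs to `s`. -/
def WrittenIn (P : RoundProtocol Q D) (s : Finset ((Q ⊕ Fin P.rdim) × ℕ))
    (d : ℕ × Fin P.rdim → D) : Prop :=
  ∀ j α, d (j, α) ≠ P.blank ↔ (Sum.inr α, j) ∈ s

theorem WrittenIn.update {P : RoundProtocol Q D} [DecidableEq ((Q ⊕ Fin P.rdim) × ℕ)]
    {s : Finset ((Q ⊕ Fin P.rdim) × ℕ)}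
    {d : ℕ × Fin P.rdim → D} (h : P.WrittenIn s d) (k : ℕ) (α : Fin P.rdim)
    (x : {x : D // x ≠ P.blank}) :
    P.WrittenIn (insert (Sum.inr α, k) s) (Function.update d (k, α) x.1) := by
  intro j β
  by_cases hj : (j, β) = (k, α)
  · cases hj
    simp [x.2]
  · rw [Function.update_of_ne hj, h j β, Finset.mem_insert, or_iff_right]
    intro h'
    cases h'
    exact hj rfl


/-- The location `l` is among the events of `s` or is the initial one. -/
def Available (P : RoundProtocol Q D) (s : Finset ((Q ⊕ Fin P.rdim) × ℕ)) (l : Q × ℕ) : Prop :=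
  (Sum.inl l.1, l.2) ∈ s ∨ l = (P.init, 0)

/-- The events of `s` can be realised: any demand `E` of processes on available locations is met
with at most one additional process per event of `s`, writing exactly the registers of `s`. -/
def Realisable (P : RoundProtocol Q D) (s : Finset ((Q ⊕ Fin P.rdim) × ℕ)) : Prop :=
  ∀ (E : (Q × ℕ) →₀ ℕ) (N : ℕ), (∀ l, E l ≠ 0 → P.Available s l) → E.degree + s.card ≤ N →
    ∃ c, P.Reach (P.initConfig N) c ∧ E ≤ c.locs ∧ P.WrittenIn s c.data

theorem realisable_empty (P : RoundProtocol Q D) : P.Realisable ∅ := by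
  classical
  intro E N hE hN
  refine ⟨_, .refl, fun l => ?_, fun j α => by simp [initConfig]⟩
  by_cases h : E l = 0
  · simp [h]
  · obtain h' | h' := hE l h
    · simp at h'
    · rw [h'] at h ⊢
      simp only [initConfig, Finsupp.single_eq_same]
      have := Finsupp.le_degree (P.init, 0) E
      omega

section

variable {P : RoundProtocol Q D} [DecidableEq ((Q ⊕ Fin P.rdim) × ℕ)]
  {s : Finset ((Q ⊕ Fin P.rdim) × ℕ)}

theorem writtenIn_insert_loc {d : ℕ × Fin P.rdim → D} {q : Q} {k : ℕ} :
    P.WrittenIn (insert (Sum.inl q, k) s) d ↔ P.WrittenIn s d := by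
  simp [WrittenIn]

theorem Realisable.insert_init (hs : P.Realisable s) :
    P.Realisable (insert (Sum.inl P.init, 0) s) := by
  intro E N hE hN
  have hcard := Finset.card_le_card (Finset.subset_insert (Sum.inl P.init, 0) s)
  obtain ⟨c, hc, hEc, hw⟩ := hs E N (by
    intro l hl
    rcases hE l hl with h | h
    · rcases Finset.mem_insert.1 h with h | h
      · obtain ⟨q, k⟩ := l
        cases h
        exact Or.inr rfl
      · exact Or.inl h
    · exact Or.inr h) (by omega)
  exact ⟨c, hc, hEc, writtenIn_insert_loc.2 hw⟩

theorem Realisable.insert_write (hs : P.Realisable s) {q q' : Q} {k : ℕ} {α : Fin P.rdim}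
    {x : {x : D // x ≠ P.blank}} (htr : (q, RoundAction.write α x, q') ∈ P.transitions)
    (hq : (Sum.inl q, k) ∈ s) (ha : (Sum.inr α, k) ∉ s) :
    P.Realisable (insert (Sum.inr α, k) s) := by
  classical
  intro E N hE hN
  rw [Finset.card_insert_of_notMem ha] at hN
  have hav : ∀ l, (E + Finsupp.single (q, k) 1 : (Q × ℕ) →₀ ℕ) l ≠ 0 → P.Available s l := by
    intro l hl
    by_cases hl' : E l = 0
    · have : l = (q, k) := by
        by_contra hne
        exact hl (by simp [hl', Ne.symm hne])
      exact Or.inl (this ▸ hq)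
    · rcases hE l hl' with h | h
      · exact Or.inl (by simpa using h)
      · exact Or.inr h
  obtain ⟨c, hc, hEc, hw⟩ := hs _ N hav (by rw [map_add, Finsupp.degree_single]; omega)
  have hpos : 0 < c.locs (q, k) := by
    have := hEc (q, k)
    simp only [Finsupp.add_apply, Finsupp.single_eq_same] at this
    omega
  refine ⟨_, hc.tail (.write c q q' k α x htr hpos), fun l => ?_, ?_⟩
  · have := le_moveOne (l' := (q', k)) (n := 0) hEc l
    simp only [Finsupp.add_apply] at this
    dsimp only
    omega
  · convert hw.update k α x

/-- Processes can be brought to the location `l'` from an available location `l`, after one process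
from an available location `l₀` has put the registers into a state that satisfies `G`. -/
theorem Realisable.insert_loc (hs : P.Realisable s) {l l' l₀ : Q × ℕ}
    (ha : (Sum.inl l'.1, l'.2) ∉ s) (hl : P.Available s l) (hl₀ : P.Available s l₀)
    (G : (ℕ × Fin P.rdim → D) → Prop) (hG : ∀ d, G d → P.WrittenIn s d)
    (hprep : ∀ (c : P.Config) (E : (Q × ℕ) →₀ ℕ), P.WrittenIn s c.data →
      E + Finsupp.single l₀ 1 ≤ c.locs → ∃ c', P.Reach c c' ∧ G c'.data ∧ E ≤ c'.locs)
    (hstep : ∀ c : P.Config, G c.data → 0 < c.locs l →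
      ∃ d, G d ∧ P.Step c ⟨moveOne c.locs l l', d⟩) :
    P.Realisable (insert (Sum.inl l'.1, l'.2) s) := by
  classical
  intro E N hE hN
  rw [Finset.card_insert_of_notMem ha] at hN
  have hsplit : E.erase l' + Finsupp.single l' (E l') = E := E.erase_add_single l'
  have hdeg : (E.erase l').degree + E l' = E.degree := by
    conv_rhs => rw [← hsplit]
    rw [map_add, Finsupp.degree_single]
  -- The demand at `l'` is rerouted to `l`, and one more process is requested at `l₀` to pay for the
  -- new event.
  have hav : ∀ m,
      (E.erase l' + Finsupp.single l (E l') + Finsupp.single l₀ 1 : (Q × ℕ) →₀ ℕ) m ≠ 0 →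
      P.Available s m := by
    intro m hm
    by_cases h1 : m = l
    · exact h1 ▸ hl
    by_cases h2 : m = l₀
    · exact h2 ▸ hl₀
    by_cases h3 : m = l'
    · subst h3
      exact absurd (by simp [Ne.symm h1, Ne.symm h2]) hm
    · have hm' : E m ≠ 0 := by
        simpa [h1, h2, h3, Finsupp.single_apply, Ne.symm h1, Ne.symm h2, Finsupp.erase_ne] using hm
      rcases hE m hm' with h | h
      · rcases Finset.mem_insert.1 h with h | h
        · exact absurd (Prod.ext (Sum.inl.inj (Prod.ext_iff.1 h).1) (Prod.ext_iff.1 h).2) h3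
        · exact Or.inl h
      · exact Or.inr h
  obtain ⟨c, hc, hEc, hw⟩ := hs _ N hav (by
    rw [map_add, map_add, Finsupp.degree_single, Finsupp.degree_single]; omega)
  obtain ⟨c₁, hc₁, hG₁, hE₁⟩ := hprep c _ hw hEc
  obtain ⟨c₂, hc₂, hG₂, hE₂⟩ := exists_reach_moveMany G hstep _ _ c₁ hG₁ hE₁
  rw [hsplit] at hE₂
  exact ⟨c₂, (hc.trans hc₁).trans hc₂, hE₂, writtenIn_insert_loc.2 (hG _ hG₂)⟩

/-- The case of `Realisable.insert_loc` in which no preparation is needed. -/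
theorem Realisable.insert_loc_of_step (hs : P.Realisable s) {l l' : Q × ℕ}
    (ha : (Sum.inl l'.1, l'.2) ∉ s) (hl : P.Available s l)
    (hstep : ∀ c : P.Config, P.WrittenIn s c.data → 0 < c.locs l →
      ∃ d, P.WrittenIn s d ∧ P.Step c ⟨moveOne c.locs l l', d⟩) :
    P.Realisable (insert (Sum.inl l'.1, l'.2) s) :=
  hs.insert_loc ha hl hl (P.WrittenIn s) (fun _ h => h)
    (fun c _ hc hE => ⟨c, .refl, hc, le_self_add.trans hE⟩) hstep

/-- The set `s` contains every event before `τ` and none after it, while ties are left free. The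
strict inequalities in a justification thus say which locations are available and which registers
are blank. -/
theorem Realisable.insert_justified (hs : P.Realisable s) {t : P.Timing}
    {τ : WithTop ℚ} (hlt : ∀ b j, t b j < τ → (b, j) ∈ s)
    (hgt : ∀ b j, τ < t b j → (b, j) ∉ s) {a : Q ⊕ Fin P.rdim} {k : ℕ}
    (ha : (a, k) ∉ s) (hj : P.Justified t τ a k) : P.Realisable (insert (a, k) s) := by
  classical
  cases hj with
  | init => exact hs.insert_init
  | incr q q' j _ hk htr hq =>
    subst hk
    exact hs.insert_loc_of_step (l := (q, j)) (l' := (q', j + 1)) ha (Or.inl (hlt _ _ hq))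
      fun c hc hpos => ⟨c.data, hc, .incr c q q' j htr hpos⟩
  | readBlank q q' _ i α htr hq hα =>
    refine hs.insert_loc_of_step (l := (q, k)) (l' := (q', k)) ha (Or.inl (hlt _ _ hq))
      fun c hc hpos => ⟨c.data, hc, .read c q q' k i α _ htr ?_ hpos⟩
    rw [Config.lookback]
    split_ifs with hi
    · by_contra h
      exact hgt _ _ (hα (k - i) (by omega)) ((hc _ _).1 h)
    · rfl
  | readWritten q q' j _ i α x w w' hk htr hq hα hwtr hw =>
    subst hk
    refine hs.insert_loc (l := (q, j + i)) (l' := (q', j + i)) (l₀ := (w, j)) ha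
      (Or.inl (hlt _ _ hq)) (Or.inl (hlt _ _ hw))
      -- One process at `(w, j)` rewrites `x`; the value then persists while all the others read it.
      (fun d => P.WrittenIn s d ∧ d (j, α) = x.1) (fun _ h => h.1) ?_ ?_
    · intro c E hc hE
      have hpos : 0 < c.locs (w, j) := by
        have := hE (w, j)
        simp only [Finsupp.add_apply, Finsupp.single_eq_same] at this
        omega
      refine ⟨_, .single (.write c w w' j α x hwtr hpos), ⟨?_, ?_⟩, fun l => ?_⟩
      · have := hc.update j α x
        rw [Finset.insert_eq_of_mem (hlt _ _ hα)] at this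
        convert this
      · simp only [Function.update_self]
      · have := le_moveOne (l' := (w', j)) (n := 0) hE l
        simp only [Finsupp.add_apply] at this
        dsimp only
        omega
    · intro c hc hpos
      refine ⟨c.data, hc, .read c q q' (j + i) i α x.1 htr ?_ hpos⟩
      rw [Config.lookback, if_pos (Nat.le_add_left _ _), Nat.add_sub_cancel, hc.2]
  | write q q' _ α x htr hq hα =>
    refine hs.insert_loc_of_step (l := (q, k)) (l' := (q', k)) ha (Or.inl (hlt _ _ hq))
      fun c hc hpos => ⟨_, ?_, .write c q q' k α x htr hpos⟩
    -- The register is already in `s`, so overwriting it, however often, does not affect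
    -- `WrittenIn`.
    have := hc.update k α x
    rw [Finset.insert_eq_of_mem (hlt _ _ hα)] at this
    convert this
  | firstWrite q q' _ α x htr hq => exact hs.insert_write htr (hlt _ _ hq) ha

end

/-- Induction adding a latest event each time: removing it leaves the set closed under earlier
events, and its justification uses only those. -/
theorem IsValid.realisable {P : RoundProtocol Q D} {t : P.Timing} (ht : P.IsValid t)
    (s : Finset ((Q ⊕ Fin P.rdim) × ℕ)) (hfin : ∀ e ∈ s, t e.1 e.2 < ⊤)
    (hclosed : ∀ e ∈ s, ∀ e' : (Q ⊕ Fin P.rdim) × ℕ, t e'.1 e'.2 < t e.1 e.2 → e' ∈ s) :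
    P.Realisable s := by
  classical
  induction s using Finset.induction_on_max_value (fun e : (Q ⊕ Fin P.rdim) × ℕ => t e.1 e.2) with
  | empty => exact P.realisable_empty
  | insert e s hes hmax ih =>
    refine (ih (fun e' he' => hfin e' (Finset.mem_insert_of_mem he')) ?_).insert_justified
      (t := t) ?_ ?_ hes
      (ht _ _ (hfin e (Finset.mem_insert_self _ _)))
    · intro e₁ he₁ e₂ h
      rcases Finset.mem_insert.1 (hclosed e₁ (Finset.mem_insert_of_mem he₁) e₂ h) with rfl | h'
      · exact absurd (hmax _ he₁) (not_le.2 h)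
      · exact h'
    · intro b j h
      rcases Finset.mem_insert.1 (hclosed e (Finset.mem_insert_self _ _) (b, j) h) with rfl | h'
      · exact absurd h (lt_irrefl _)
      · exact h'
    · intro b j h hb
      exact absurd (hmax _ hb) (not_le.2 h)

/-- Forgetting the rounds after `κ`. -/
theorem IsValid.truncate {P : RoundProtocol Q D} {t : P.Timing} (ht : P.IsValid t) (κ : ℕ) :
    P.IsValid fun a j => if j ≤ κ then t a j else ⊤ := by
  intro a k hak
  dsimp only at hak ⊢
  by_cases hk : k ≤ κ
  · rw [if_pos hk] at hak ⊢
    refine Justified.transport (δ := 0) (Or.inl rfl) ?_ ?_ (ht a k hak)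
    · intro b j hj _ h
      rwa [if_pos (hj.trans hk)]
    · intro α j _ hj _ h
      rwa [if_pos (hj.trans hk)]
  · rw [if_neg hk] at hak
    exact absurd hak (lt_irrefl _)

/-- A location that is occupied in a valid timing is occupied in a concrete execution, with a number
of processes linear in its round. -/
theorem IsValid.exists_reach [Fintype Q] {P : RoundProtocol Q D} {t : P.Timing} (ht : P.IsValid t)
    {q : Q} {k : ℕ} (hq : t (Sum.inl q) k < ⊤) {N : ℕ}
    (hN : 1 + (Fintype.card Q + P.rdim) * (k + 1) ≤ N) :
    ∃ c, P.Reach (P.initConfig N) c ∧ 0 < c.locs (q, k) := by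
  classical
  -- No justification looks at later rounds; dropping those after `k` leaves finitely many events.
  let t' : P.Timing := fun a j => if j ≤ k then t a j else ⊤
  let u : Finset ((Q ⊕ Fin P.rdim) × ℕ) := Finset.univ ×ˢ Finset.range (k + 1)
  let s := u.filter fun e => t' e.1 e.2 < ⊤
  have hmem : ∀ e, e ∈ s ↔ t' e.1 e.2 < ⊤ := by
    intro e
    simp only [s, u, Finset.mem_filter, Finset.mem_product, Finset.mem_univ, true_and,
      Finset.mem_range, and_iff_right_iff_imp]
    intro h
    by_contra hk
    simp only [t', if_neg (show ¬ e.2 ≤ k by omega)] at h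
    exact lt_irrefl _ h
  have hcard : s.card ≤ (Fintype.card Q + P.rdim) * (k + 1) := by
    refine (Finset.card_filter_le _ _).trans ?_
    simp [u]
  have hqs : (Sum.inl q, k) ∈ s := by
    rw [hmem]
    simpa only [t', le_refl, if_true] using hq
  obtain ⟨c, hc, hE, -⟩ := (ht.truncate k).realisable s (fun e he => (hmem e).1 he)
    (fun e he e' h => (hmem e').2 (h.trans ((hmem e).1 he))) (Finsupp.single (q, k) 1) N
    (fun l hl => by
      have : l = (q, k) := by
        by_contra hne
        exact hl (by simp [Ne.symm hne])
      exact Or.inl (this ▸ hqs))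
    (by rw [Finsupp.degree_single]; omega)
  refine ⟨c, hc, ?_⟩
  have := hE (q, k)
  rw [Finsupp.single_eq_same] at this
  omega

end RoundProtocol

/-! ### The polynomial bounds. -/

theorem mainTheorem6 :
    ∃ p r : Polynomial ℕ,
      ∀ (Q D : Type*) [Fintype Q] [Fintype D] (P : RoundProtocol Q D) (qerr : Q),
        ¬ P.IsSafe qerr →
          ∃ K N : ℕ, K = 2 ^ (p.eval P.size) ∧ N = 2 ^ (r.eval P.size) ∧
            ∃ k ≤ K, ∃ c : P.Config,
              P.Reach (P.initConfig N) c ∧ 0 < c.locs (qerr, k) := by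
  -- The square is the exponent in `IsValid.exists_le`; the summand `X` absorbs the added `P.vis`
  -- through `S + 1 ≤ 2 ^ S`. In the second polynomial, `X + 1` likewise absorbs the factor `2 * (S
  -- + 1)` from the linear process count.
  let p : Polynomial ℕ := .X + (.X * (.X + 1) + 1) ^ 2
  refine ⟨p, p + .X + 1, ?_⟩
  intro Q D _ _ P qerr hsafe
  refine ⟨_, _, rfl, rfl, ?_⟩
  simp only [RoundProtocol.IsSafe, not_forall] at hsafe
  obtain ⟨n, c, hc, k, hk⟩ := hsafe
  obtain ⟨t, ht⟩ := RoundProtocol.exists_accounts_of_reach hc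
  obtain ⟨k', hk', t', ht', hfin⟩ := ht.valid.exists_le (ht.loc _ _ (Nat.pos_of_ne_zero hk))
  set S := P.size with hS
  have hQ : Fintype.card Q + P.rdim ≤ S := by rw [hS, RoundProtocol.size]; omega
  have hv : P.vis ≤ S := by rw [hS, RoundProtocol.size]; omega
  have hp : p.eval S = S + (S * (S + 1) + 1) ^ 2 := by simp [p]
  have hK : k' ≤ 2 ^ p.eval S := by
    have h1 : 2 ^ ((Fintype.card Q + P.rdim) * (P.vis + 1) + 1) ^ 2
        ≤ 2 ^ (S * (S + 1) + 1) ^ 2 := by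
      gcongr
      norm_num
    have h2 : S + 1 ≤ 2 ^ S := Nat.lt_two_pow_self
    have h3 : 1 ≤ 2 ^ (S * (S + 1) + 1) ^ 2 := Nat.one_le_two_pow
    calc k' ≤ S + 2 ^ (S * (S + 1) + 1) ^ 2 := by omega
      _ ≤ (S + 1) * 2 ^ (S * (S + 1) + 1) ^ 2 := by nlinarith
      _ ≤ 2 ^ S * 2 ^ (S * (S + 1) + 1) ^ 2 := by gcongr
      _ = 2 ^ p.eval S := by rw [hp, pow_add]
  refine ⟨k', hK, ht'.exists_reach hfin ?_⟩
  have h2 : S + 1 ≤ 2 ^ S := Nat.lt_two_pow_self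
  have h3 : 1 ≤ 2 ^ p.eval S := Nat.one_le_two_pow
  calc 1 + (Fintype.card Q + P.rdim) * (k' + 1) ≤ 1 + S * (2 ^ p.eval S + 1) := by gcongr
    _ ≤ (S + 1) * (2 ^ p.eval S * 2) := by nlinarith
    _ ≤ 2 ^ S * (2 ^ p.eval S * 2) := by gcongr
    _ = 2 ^ (p + .X + 1 : Polynomial ℕ).eval S := by
      simp only [Polynomial.eval_add, Polynomial.eval_X, Polynomial.eval_one]
      ring
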